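/- Let $V$ be a Euclidean Jordan algebra, that is, a finite-dimensional real inner product space with a commutative bilinear product that has a unit, satisfies the Jordan identity $(xy)x^2=x(yx^2)$, and for which $\langle xy,z\rangle=\langle y,xz\rangle$ for all $x,y,z\in V$. Let $Q=\{x^2: x\in V\}$ be its cone of squares, and let $\le_Q$ be the order defined by $x\le_Q y \iff y-x\in Q$. For a nonempty closed convex set $D\subset V$ let $P_D$ denote the metric (nearest point) projection onto $D$. A set $M\subset V$ is called lattice-like if $P_{x-Q}\,y\in M$ and $P_{x+Q}\,y\in M$ for all $x,y\in M$. The rank of $V$ is the largest degree of the minimal polynomial of an element of $V$. Theorem. Suppose that $V$ is simple (it is nonzero and its only ideals are $\{0\}$ and $V$) and has rank $r\ge 3$. Then $V$ contains no lattice-like hyperplane: for all $u,a\in V$ with $a\ne 0$, the hyperplane $H=\{x\in V:\langle a,x\rangle=\langle a,u\rangle\}$ is not lattice-like. Equivalently, the projection $P_H$ onto such a hyperplane is never $Q$-isotone, i.e. there are $x,y\in V$ with $x\le_Q y$ but $P_Hx\not\le_Q P_Hy$. -/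

import Mathlib

open scoped RealInnerProductSpace

/-! ### Ordered Euclidean spaces: projections, lattice-like operations, isotonicity -/

section OrderedEuclidean

variable {E : Type*} [NormedAddCommGroup E] [InnerProductSpace ℝ E]

/-- `p` is a nearest point to `x` in `D`: it lies in `D` and `‖x - p‖ = inf {‖x - y‖ : y ∈ D}`. -/
def IsNearestPoint (D : Set E) (x p : E) : Prop :=
  p ∈ D ∧ ‖x - p‖ = ⨅ y : D, ‖x - (y : E)‖

/-- The metric projection `P_D` onto `D`. It is meant for nonempty closed convex subsets of a
finite-dimensional (or just complete) space, where the nearest point exists and is unique. -/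
noncomputable def metricProj (D : Set E) (x : E) : E :=
  Classical.epsilon fun p => IsNearestPoint D x p

theorem isNearestPoint_unique {D : Set E} (hD : Convex ℝ D) {x p q : E}
    (hp : IsNearestPoint D x p) (hq : IsNearestPoint D x q) : p = q := by
  have h1 := (norm_eq_iInf_iff_real_inner_le_zero hD hp.1).1 hp.2 q hq.1
  have h2 := (norm_eq_iInf_iff_real_inner_le_zero hD hq.1).1 hq.2 p hp.1
  have h3 : ⟪q - p, q - p⟫ = ⟪x - p, q - p⟫ + ⟪x - q, p - q⟫ := by
    simp only [inner_sub_left, inner_sub_right]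
    ring
  have h4 : ⟪q - p, q - p⟫ ≤ 0 := by linarith
  have h5 : q - p = 0 := inner_self_eq_zero.1 (le_antisymm h4 real_inner_self_nonneg)
  exact (sub_eq_zero.1 h5).symm

theorem isNearestPoint_metricProj [CompleteSpace E] {D : Set E} (hne : D.Nonempty)
    (hcl : IsClosed D) (hD : Convex ℝ D) (x : E) : IsNearestPoint D x (metricProj D x) :=
  Classical.epsilon_spec (p := fun p => IsNearestPoint D x p)
    (exists_norm_eq_iInf_of_complete_convex hne hcl.isComplete hD x)

/-- The lattice-like operation `x ⊓_K y = P_{x - K} y`. -/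
noncomputable def latMeet (K : Set E) (x y : E) : E :=
  metricProj ((fun k => x - k) '' K) y

/-- The lattice-like operation `x ⊔_K y = P_{x + K} y`. -/
noncomputable def latJoin (K : Set E) (x y : E) : E :=
  metricProj ((fun k => x + k) '' K) y

/-- `M` is a lattice-like subset of `(E, K)`: it is invariant under `⊓_K` and `⊔_K`. -/
def IsLatticeLike (K M : Set E) : Prop :=
  ∀ x ∈ M, ∀ y ∈ M, latMeet K x y ∈ M ∧ latJoin K x y ∈ M

/-- The relation `x ≤_K y`, that is `y - x ∈ K`. -/
def coneLE (K : Set E) (x y : E) : Prop := y - x ∈ K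

/-- The projection `P_C` is `K`-isotone: `x ≤_K y` implies `P_C x ≤_K P_C y`. -/
def IsIsotoneProj (K C : Set E) : Prop :=
  ∀ x y : E, coneLE K x y → coneLE K (metricProj C x) (metricProj C y)

/-- The hyperplane `H(u, a)` through `u` with normal `a` (a hyperplane when `a ≠ 0`). -/
def hyperplane (u a : E) : Set E := {x | ⟪a, x⟫ = ⟪a, u⟫}

end OrderedEuclidean

/-! ### Euclidean Jordan algebras -/

/-- A Euclidean Jordan algebra: a finite-dimensional real inner product space with a commutative
bilinear product that has a unit `1`, satisfies the Jordan identity `(xy)x² = x(yx²)`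
(`IsCommJordan`), and for which the inner product is associative,
`⟪xy, z⟫ = ⟪y, xz⟫`. -/
class EuclideanJordanAlgebra (V : Type*) extends
    NonAssocCommRing V, NormedAddCommGroup V, InnerProductSpace ℝ V, IsCommJordan V where
  smul_mul : ∀ (t : ℝ) (x y : V), (t • x) * y = t • (x * y)
  finiteDimensional : FiniteDimensional ℝ V
  inner_mul_left : ∀ x y z : V, ⟪x * y, z⟫ = ⟪y, x * z⟫

attribute [instance] EuclideanJordanAlgebra.finiteDimensional

section Jordan

variable (V : Type*) [EuclideanJordanAlgebra V]

/-- The cone of squares `Q = {x² : x ∈ V}`. -/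
def squareCone : Set V := {y | ∃ x : V, y = x * x}

variable {V}

/-- The powers in a Jordan algebra: `x⁰ = 1`, `xⁿ⁺¹ = x xⁿ`. -/
def jordanPow (x : V) : ℕ → V
  | 0 => 1
  | n + 1 => x * jordanPow x n

/-- The degree of the minimal polynomial of `x`: the least `k > 0` such that
`1, x, …, xᵏ` are linearly dependent. -/
noncomputable def jordanDegree (x : V) : ℕ :=
  sInf {k : ℕ | 0 < k ∧ ¬ LinearIndependent ℝ (fun i : Fin (k + 1) => jordanPow x i)}

theorem jordanDegree_le (x : V) : jordanDegree x ≤ Module.finrank ℝ V + 1 := by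
  refine Nat.sInf_le ⟨Nat.succ_pos _, fun h => ?_⟩
  have := h.fintype_card_le_finrank
  simp only [Fintype.card_fin] at this
  omega

variable (V)

/-- The rank of a Euclidean Jordan algebra: the largest degree of the minimal polynomial of an
element (the set of degrees is bounded, see `bddAbove_jordanDegree`). -/
noncomputable def jordanRank : ℕ := sSup (Set.range fun x : V => jordanDegree x)

theorem bddAbove_jordanDegree : BddAbove (Set.range fun x : V => jordanDegree x) :=
  ⟨Module.finrank ℝ V + 1, by rintro _ ⟨x, rfl⟩; exact jordanDegree_le x⟩

/-- `V` is simple: it is nonzero and its only ideals (linear subspaces `I` with `V I ⊆ I`) are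
`0` and `V`. -/
def IsSimpleJordan : Prop :=
  Nontrivial V ∧ ∀ I : Submodule ℝ V, (∀ x : V, ∀ y ∈ I, x * y ∈ I) → I = ⊥ ∨ I = ⊤

end Jordan

/-! Let `p`, `q` be orthogonal idempotents on which `⟪a, ·⟫` has the same strict sign. They lie in
the self-polar cone `Q`, and a positive combination `s • p - t • q` is orthogonal to `a`. Moreau's
decomposition then moves a meet off the hyperplane, and the projection reverses the sign of a
pairing with `q` (`not_isLatticeLike_hyperplane`, `not_isIsotoneProj_hyperplane`).

Such a pair exists (`not_separatesIdempotents`). Otherwise the spectral theorem forces `a = α • c -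
β • d`, up to sign, with `c`, `d` orthogonal idempotents, and each of them acts as a primitive
idempotent on the elements annihilated by the other (`SeparatesIdempotents.mul_eq_smul`). The Peirce
1/2-space of `1 - c - d` then vanishes, its Peirce 1-space is an ideal, and simplicity gives `c + d
= 1`. In that case every element satisfies a quadratic equation, so the rank is at most 2. -/

/-! ### Power associativity, spectral theorem, positivity of the cone of squares. -/

section JordanSpectral

variable {V : Type*} [EuclideanJordanAlgebra V]

instance EuclideanJordanAlgebra.isScalarTower : IsScalarTower ℝ V V :=
  ⟨fun t x y => EuclideanJordanAlgebra.smul_mul t x y⟩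

instance EuclideanJordanAlgebra.smulCommClass : SMulCommClass ℝ V V :=
  ⟨fun t x y => by
    simp only [smul_eq_mul]
    rw [mul_comm x (t • y), EuclideanJordanAlgebra.smul_mul, mul_comm y x]⟩

open EuclideanJordanAlgebra

/-- Polarization of the Jordan identity, applied to `y`; the Peirce rules below are specializations
of it. -/
theorem jordan_linearized (x y z : V) :
    (2 : ℝ) • (x * ((x * z) * y)) - (2 : ℝ) • ((x * z) * (x * y)) + z * ((x * x) * y)
      - (x * x) * (z * y) = 0 := by
  have h : (2 : ℕ) • ((x * ((x * z) * y) - (x * z) * (x * y))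
      + (x * ((z * x) * y) - (z * x) * (x * y)) + (z * ((x * x) * y) - (x * x) * (z * y))) = 0 :=
    congrArg (fun F : AddMonoid.End V => F y) (two_nsmul_lie_lmul_lmul_add_add_eq_zero x x z)
  rw [two_nsmul, mul_comm z x] at h
  have h2 := congrArg (fun w : V => (1 / 2 : ℝ) • w) h
  simp only [smul_zero] at h2
  rw [← h2]
  module

theorem jordan_identity (x y : V) : (x * y) * (x * x) = x * (y * (x * x)) :=
  IsCommJordan.lmul_comm_rmul_rmul x y

theorem sq_mul_comm (x y : V) : (x * x) * (x * y) = x * ((x * x) * y) := by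
  rw [mul_comm, jordan_identity, mul_comm y]

theorem sq_mul_jordanPow (x : V) (n : ℕ) : (x * x) * jordanPow x n = jordanPow x (n + 2) := by
  induction n with
  | zero => simp [jordanPow]
  | succ n ih => rw [jordanPow, sq_mul_comm, ih]; rfl

theorem jordanPow_mul_comm (x : V) (n : ℕ) :
    ∀ y : V, jordanPow x n * (x * y) = x * (jordanPow x n * y) := by
  induction n using Nat.strong_induction_on with
  | _ n ih =>
    match n with
    | 0 => intro y; simp [jordanPow]
    | 1 => intro y; simp [jordanPow]
    | n + 2 =>
      intro y
      have h0 := ih n (by omega)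
      have h1 := ih (n + 1) (by omega)
      -- A recursion writing multiplication by `xⁿ⁺²` through operators already known to commute
      -- with multiplication by `x`.
      have key : ∀ z : V, jordanPow x (n + 2) * z = (x * x) * (jordanPow x n * z)
          + (2 : ℝ) • (jordanPow x (n + 1) * (x * z))
          - (2 : ℝ) • (x * (jordanPow x n * (x * z))) := by
        intro z
        have h := jordan_linearized x (jordanPow x n) z
        rw [sq_mul_jordanPow, show x * jordanPow x n = jordanPow x (n + 1) from rfl] at h
        rw [mul_comm (jordanPow x (n + 2)), mul_comm (jordanPow x n) z,
          mul_comm (jordanPow x (n + 1)), mul_comm (jordanPow x n) (x * z)]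
        rw [← sub_eq_zero, ← h]
        module
      rw [key, key, mul_sub, mul_add, mul_smul_comm, mul_smul_comm, h0, sq_mul_comm, h1 (x * y),
        h0 (x * y), h0 y]

/-- The spectral theorem: every element is a real combination of finitely many orthogonal
idempotents with sum `1`. -/
theorem exists_spectral_decomposition (x : V) : ∃ (s : Finset ℝ) (c : ℝ → V),
    (∀ i ∈ s, c i * c i = c i) ∧ (∀ i ∈ s, ∀ j ∈ s, i ≠ j → c i * c j = 0) ∧
      ∑ i ∈ s, c i = 1 ∧ ∑ i ∈ s, i • c i = x := by
  classical
  let W : Submodule ℝ V := Submodule.span ℝ (Set.range (jordanPow x))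
  have hW : ∀ w ∈ W, LinearMap.mulLeft ℝ x w ∈ W := by
    intro w hw
    refine Submodule.span_induction (p := fun w _ => LinearMap.mulLeft ℝ x w ∈ W)
      ?_ ?_ ?_ ?_ hw
    · rintro _ ⟨n, rfl⟩
      exact Submodule.subset_span ⟨n + 1, rfl⟩
    · simp
    · intro u v _ _ hu hv
      rw [map_add]; exact W.add_mem hu hv
    · intro t u _ hu
      rw [map_smul]; exact W.smul_mem t hu
  have hcomm : ∀ w ∈ W, ∀ y : V, w * (x * y) = x * (w * y) := by
    intro w hw
    refine Submodule.span_induction (p := fun w _ => ∀ y : V, w * (x * y) = x * (w * y))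
      ?_ ?_ ?_ ?_ hw
    · rintro _ ⟨n, rfl⟩
      exact jordanPow_mul_comm x n
    · simp
    · intro u v _ _ hu hv y
      rw [add_mul, add_mul, mul_add, hu, hv]
    · intro t u _ hu y
      rw [smul_mul_assoc, smul_mul_assoc, mul_smul_comm, hu]
  let T : W →ₗ[ℝ] W := (LinearMap.mulLeft ℝ x).restrict hW
  have hT : T.IsSymmetric := by
    intro u v
    exact inner_mul_left x (u : V) (v : V)
  have htop : (⨆ μ, Module.End.eigenspace T μ) = ⊤ :=
    (Submodule.orthogonal_eq_bot_iff).1 hT.orthogonalComplement_iSup_eigenspaces_eq_bot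
  have h1 : (⟨1, Submodule.subset_span ⟨0, rfl⟩⟩ : W) ∈ ⨆ μ, Module.End.eigenspace T μ := by
    rw [htop]; trivial
  obtain ⟨f, hf, hsum⟩ := (Submodule.mem_iSup_iff_exists_finsupp _ _).1 h1
  have hf' : ∀ i, x * (f i : V) = i • (f i : V) := by
    intro i
    exact congrArg Subtype.val (Module.End.mem_eigenspace_iff.1 (hf i))
  have hsum1 : ∑ i ∈ f.support, (f i : V) = 1 := by
    have := congrArg Subtype.val hsum
    simpa [Finsupp.sum] using this
  -- By `hcomm`, the product is an eigenvector for both eigenvalues `i` and `j`.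
  have horth : ∀ i j, i ≠ j → (f i : V) * (f j : V) = 0 := by
    intro i j hij
    have e1 : x * ((f i : V) * (f j : V)) = j • ((f i : V) * (f j : V)) := by
      rw [← hcomm _ (f i).2, hf', mul_smul_comm]
    have e2 : x * ((f i : V) * (f j : V)) = i • ((f i : V) * (f j : V)) := by
      rw [mul_comm (f i : V), ← hcomm _ (f j).2, hf', mul_smul_comm]
    have e3 : (i - j) • ((f i : V) * (f j : V)) = 0 := by
      rw [sub_smul, ← e1, ← e2, sub_self]
    exact (smul_eq_zero.1 e3).resolve_left (sub_ne_zero.2 hij)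
  refine ⟨f.support, fun i => (f i : V), ?_, fun i _ j _ => horth i j, hsum1, ?_⟩
  · intro i hi
    have e := congrArg (fun v : V => (f i : V) * v) hsum1
    simp only [mul_one, Finset.mul_sum] at e
    rwa [Finset.sum_eq_single i (fun j _ hj => horth i j hj.symm) (fun h => absurd hi h)] at e
  · have e := congrArg (fun v : V => x * v) hsum1
    simp only [mul_one, Finset.mul_sum, hf'] at e
    exact e

/-- The Peirce polynomial of an idempotent. -/
theorem peirce_cubic {c : V} (hc : c * c = c) (x : V) :
    (2 : ℝ) • (c * (c * (c * x))) - (3 : ℝ) • (c * (c * x)) + c * x = 0 := by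
  have h := jordan_linearized c c x
  rw [hc, hc, mul_comm x c, mul_comm (c * x) c] at h
  rw [← h]
  module

/-- Multiplication by `c` is self-adjoint with eigenvalues among 0, 1/2, 1, where `t = t² + 4 (t -
t²)²`. -/
theorem inner_idempotent_mul_self {c : V} (hc : c * c = c) (x : V) :
    ⟪c * x, x⟫ = ⟪c * x, c * x⟫ + 4 * ⟪c * x - c * (c * x), c * x - c * (c * x)⟫ := by
  have h := peirce_cubic hc x
  have h1 : ∀ y z : V, ⟪c * y, z⟫ = ⟪y, c * z⟫ := inner_mul_left c
  have h2 := congrArg (fun w => ⟪x, w⟫) h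
  have h3 := congrArg (fun w => ⟪x, c * w⟫) h
  simp only [mul_add, mul_sub, mul_smul_comm, inner_add_right, inner_sub_right,
    inner_sub_left, inner_smul_right, inner_zero_right, mul_zero, h1] at h2 h3 ⊢
  linarith

theorem inner_idempotent_mul_self_nonneg {c : V} (hc : c * c = c) (x : V) :
    0 ≤ ⟪c * x, x⟫ := by
  rw [inner_idempotent_mul_self hc]
  have h1 := real_inner_self_nonneg (x := c * x)
  have h2 := real_inner_self_nonneg (x := c * x - c * (c * x))
  linarith

theorem mul_eq_zero_of_inner_mul_self {c : V} (hc : c * c = c) {x : V}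
    (h : ⟪c * x, x⟫ = 0) : c * x = 0 := by
  rw [inner_idempotent_mul_self hc] at h
  have h1 := real_inner_self_nonneg (x := c * x)
  have h2 := real_inner_self_nonneg (x := c * x - c * (c * x))
  exact inner_self_eq_zero.1 (by linarith : ⟪c * x, c * x⟫ = 0)

theorem inner_mul_self_right (c x : V) : ⟪c, x * x⟫ = ⟪c * x, x⟫ := by
  rw [← inner_mul_left, mul_comm]

theorem inner_idempotent_nonneg {c p : V} (hc : c * c = c) (hp : p * p = p) : 0 ≤ ⟪c, p⟫ := by
  rw [← hp, inner_mul_self_right]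
  exact inner_idempotent_mul_self_nonneg hc p

theorem mul_eq_zero_of_inner_eq_zero {c p : V} (hc : c * c = c) (hp : p * p = p)
    (h : ⟪c, p⟫ = 0) : c * p = 0 := by
  rw [← hp, inner_mul_self_right] at h
  exact mul_eq_zero_of_inner_mul_self hc h

theorem inner_eq_zero_of_mul_eq_zero {c p : V} (hp : p * p = p) (h : c * p = 0) :
    ⟪c, p⟫ = 0 := by
  rw [← hp, inner_mul_self_right, h, inner_zero_left]

theorem mul_self_of_spectral {s : Finset ℝ} {c : ℝ → V} (hc : ∀ i ∈ s, c i * c i = c i)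
    (ho : ∀ i ∈ s, ∀ j ∈ s, i ≠ j → c i * c j = 0) :
    (∑ i ∈ s, i • c i) * (∑ i ∈ s, i • c i) = ∑ i ∈ s, (i * i) • c i := by
  rw [Finset.sum_mul_sum]
  refine Finset.sum_congr rfl fun i hi => ?_
  rw [Finset.sum_eq_single i _ (fun h => absurd hi h)]
  · rw [smul_mul_smul_comm, hc i hi]
  · intro j hj hij
    rw [smul_mul_smul_comm, ho i hi j hj hij.symm, smul_zero]

/-- The cone of squares is contained in its dual cone. -/
theorem inner_mul_self_mul_self_nonneg (x y : V) : 0 ≤ ⟪x * x, y * y⟫ := by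
  obtain ⟨s, c, hc, ho, -, rfl⟩ := exists_spectral_decomposition x
  rw [mul_self_of_spectral hc ho, sum_inner]
  refine Finset.sum_nonneg fun i hi => ?_
  rw [real_inner_smul_left, inner_mul_self_right]
  exact mul_nonneg (mul_self_nonneg i) (inner_idempotent_mul_self_nonneg (hc i hi) y)

/-- The spectral idempotents of an element annihilated by an idempotent `d` are annihilated
by `d`. -/
theorem mul_spectral_eq_zero {s : Finset ℝ} {c : ℝ → V} (hc : ∀ i ∈ s, c i * c i = c i)
    (ho : ∀ i ∈ s, ∀ j ∈ s, i ≠ j → c i * c j = 0) {d : V} (hd : d * d = d)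
    (h : d * ∑ i ∈ s, i • c i = 0) {i : ℝ} (hi : i ∈ s) (hi0 : i ≠ 0) : d * c i = 0 := by
  have h1 : ⟪d, (∑ i ∈ s, i • c i) * (∑ i ∈ s, i • c i)⟫ = 0 := by
    rw [inner_mul_self_right, h, inner_zero_left]
  rw [mul_self_of_spectral hc ho, inner_sum] at h1
  have h2 := (Finset.sum_eq_zero_iff_of_nonneg (fun j hj => by
    rw [real_inner_smul_right]
    exact mul_nonneg (mul_self_nonneg j) (inner_idempotent_nonneg hd (hc j hj)))).1 h1 i hi
  rw [real_inner_smul_right] at h2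
  exact mul_eq_zero_of_inner_eq_zero hd (hc i hi)
    ((mul_eq_zero.1 h2).resolve_left (mul_self_ne_zero.2 hi0))

end JordanSpectral

/-! ### Normals that separate idempotents force rank at most 2. -/

section JordanHyperplane

variable {V : Type*} [EuclideanJordanAlgebra V]

open EuclideanJordanAlgebra

theorem idempotent_mul_comm {c d : V} (hc : c * c = c) (hcd : c * d = 0) (x : V) :
    c * (d * x) = d * (c * x) := by
  have h := jordan_linearized c x d
  rw [hcd, hc, zero_mul, mul_zero, zero_mul, smul_zero, sub_zero, zero_add] at h
  exact (sub_eq_zero.1 h).symm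

theorem idempotent_one_sub_sub {c d : V} (hc : c * c = c) (hd : d * d = d) (hcd : c * d = 0) :
    (1 - c - d) * (1 - c - d) = 1 - c - d := by
  simp only [mul_sub, sub_mul, mul_one, one_mul, hc, hd, hcd, mul_comm d c]
  abel

/-- The functional `⟪a, ·⟫` never has the same strict sign on two orthogonal idempotents. -/
def SeparatesIdempotents (a : V) : Prop :=
  ∀ p q : V, p * p = p → q * q = q → p * q = 0 → ⟪a, p⟫ * ⟪a, q⟫ ≤ 0

theorem SeparatesIdempotents.neg {a : V} (h : SeparatesIdempotents a) :
    SeparatesIdempotents (-a) := by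
  intro p q hp hq hpq
  rw [inner_neg_left, inner_neg_left, neg_mul_neg]
  exact h p q hp hq hpq

/-- For a spectral idempotent `p` of `x` with nonzero eigenvalue, `p` and `1 - p - d` are orthogonal
to each other and to `d`. Separation then makes `c` orthogonal to one of them, so `c * p` is `0` or
`c`. -/
theorem SeparatesIdempotents.mul_eq_smul {a : V} (h : SeparatesIdempotents a) {α β : ℝ}
    (hα : 0 < α) {c d : V} (hc : c * c = c) (hd : d * d = d) (hcd : c * d = 0)
    (ha : a = α • c - β • d) {x : V} (hx : d * x = 0) : ∃ κ : ℝ, c * x = κ • c := by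
  classical
  obtain ⟨s, p, hp, ho, -, rfl⟩ := exists_spectral_decomposition x
  have key : ∀ i ∈ s, ∃ κ : ℝ, c * (i • p i) = κ • c := by
    intro i hi
    by_cases hi0 : i = 0
    · exact ⟨0, by rw [hi0, zero_smul, mul_zero, zero_smul]⟩
    have hdp := mul_spectral_eq_zero hp ho hd hx hi hi0
    have hpd : p i * d = 0 := by rw [mul_comm, hdp]
    have hq := idempotent_one_sub_sub (hp i hi) hd hpd
    have hpq : p i * (1 - p i - d) = 0 := by
      rw [mul_sub, mul_sub, mul_one, hp i hi, hpd]; abel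
    have hdq : d * (1 - p i - d) = 0 := by
      rw [mul_sub, mul_sub, mul_one, hd, hdp]; abel
    have h1 := h _ _ (hp i hi) hq hpq
    rw [ha, inner_sub_left, inner_sub_left, real_inner_smul_left, real_inner_smul_left,
      real_inner_smul_left, real_inner_smul_left, inner_eq_zero_of_mul_eq_zero (hp i hi) hdp,
      inner_eq_zero_of_mul_eq_zero hq hdq] at h1
    have n1 := inner_idempotent_nonneg hc (hp i hi)
    have n2 := inner_idempotent_nonneg hc hq
    have h2 : ⟪c, p i⟫ * ⟪c, 1 - p i - d⟫ = 0 := by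
      refine le_antisymm ?_ (mul_nonneg n1 n2)
      refine nonpos_of_mul_nonpos_right ?_ (mul_pos hα hα)
      linarith
    rcases mul_eq_zero.1 h2 with h3 | h3
    · exact ⟨0, by
        rw [mul_smul_comm, mul_eq_zero_of_inner_eq_zero hc (hp i hi) h3, smul_zero, zero_smul]⟩
    · have h4 := mul_eq_zero_of_inner_eq_zero hc hq h3
      rw [mul_sub, mul_sub, mul_one, hcd, sub_zero, sub_eq_zero] at h4
      exact ⟨i, by rw [mul_smul_comm, ← h4]⟩
  choose! κ hκ using key
  exact ⟨∑ i ∈ s, κ i, by rw [Finset.mul_sum, Finset.sum_smul]; exact Finset.sum_congr rfl hκ⟩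

theorem eq_zero_of_add_mul_eq_half {c d : V} (hc : c * c = c) (hcd : c * d = 0)
    (hK : ∀ x : V, d * x = 0 → ∃ κ : ℝ, c * x = κ • c) {v : V}
    (hv : (c + d) * v = (1 / 2 : ℝ) • v) (hd : d * d = d) : c * v = 0 := by
  have hcomm := idempotent_mul_comm hc hcd
  have e1 : ∀ n : V, (c + d) * n = (1 / 2 : ℝ) • n → d * n = (1 / 2 : ℝ) • n - c * n := by
    intro n hn
    rw [← hn, add_mul]; abel
  have hw : ∀ n : V, (c + d) * n = (1 / 2 : ℝ) • n → (c + d) * (c * n) = (1 / 2 : ℝ) • (c * n) := by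
    intro n hn
    rw [add_mul, ← hcomm, ← mul_add, ← add_mul, hn, mul_smul_comm]
  have hv1 := hw v hv
  have hv2 := hw _ hv1
  have d1 := e1 _ hv
  have d2 := e1 _ hv1
  have d3 := e1 _ hv2
  have h1 := peirce_cubic hc v
  have h2 := peirce_cubic hd v
  simp only [d1, mul_sub, mul_smul_comm, d2, d3] at h2
  -- On the 1/2-space of `c + d`, `d` acts as `1/2 - c`; the two Peirce cubics leave only the
  -- eigenvalues 0 and 1/2 for `c`.
  have h3 : c * (c * v) = (1 / 2 : ℝ) • (c * v) := by
    linear_combination (norm := module) (-1 / 3 : ℝ) • h1 + (-1 / 3 : ℝ) • h2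
  -- Now `c * v` is a multiple of `c`, hence of eigenvalue 1 as well as 1/2.
  obtain ⟨κ, hκ⟩ := hK (c * v) (by rw [d2, h3, sub_self])
  have h4 : c * v = (2 : ℝ) • κ • c := by
    rw [← hκ, h3, smul_smul]; norm_num
  have h5 : c * (c * v) = c * v := by
    rw [h4, mul_smul_comm, mul_smul_comm, hc]
  rw [h5] at h3
  have h6 : (1 / 2 : ℝ) • (c * v) = 0 := by
    have : (1 / 2 : ℝ) • (c * v) = c * v - (1 / 2 : ℝ) • (c * v) := by module
    rw [this, ← h3, sub_self]
  exact (smul_eq_zero.1 h6).resolve_left (by norm_num)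

/-- If `e` has no Peirce `1/2`-space then its Peirce `1`-space is an ideal. -/
theorem mul_mem_peirce_one {e : V} (he : e * e = e) (h : ∀ x : V, e * (e * x) = e * x)
    (y : V) {x : V} (hx : e * x = x) : e * (y * x) = y * x := by
  have h0 : e * (y - e * y) = 0 := by rw [mul_sub, h, sub_self]
  have h1 : ∀ z : V, e * (x * z) = x * (e * z) := by
    intro z
    have := jordan_linearized e z x
    rw [he, hx] at this
    rw [← sub_eq_zero, ← this]
    module
  have h2 : e * ((y - e * y) * x) = (y - e * y) * x := by
    have := jordan_linearized e x (y - e * y)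
    rw [he, h0, hx, zero_mul, mul_zero, smul_zero, sub_self, zero_add] at this
    exact (sub_eq_zero.1 this).symm
  -- The Peirce 0- and 1-spaces annihilate each other: by `h2` this product has eigenvalue 1, by
  -- `h1` eigenvalue 0.
  have h3 : x * (y - e * y) = 0 := by
    rw [mul_comm, ← h2, mul_comm (y - e * y), h1, h0, mul_zero]
  rw [mul_sub, sub_eq_zero] at h3
  rw [mul_comm y x, h1, ← h3]

theorem add_eq_one_of_simple (hsimple : IsSimpleJordan V) {c d : V} (hc : c * c = c)
    (hd : d * d = d) (hcd : c * d = 0) (hc0 : c ≠ 0)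
    (hK : ∀ x : V, d * x = 0 → ∃ κ : ℝ, c * x = κ • c)
    (hK' : ∀ x : V, c * x = 0 → ∃ κ : ℝ, d * x = κ • d) : c + d = 1 := by
  have he := idempotent_one_sub_sub hc hd hcd
  have hdc : d * c = 0 := by rw [mul_comm, hcd]
  set e := 1 - c - d with he_def
  have hsum : c + d = 1 - e := by rw [he_def]; abel
  have hee : ∀ x : V, e * (e * x) = e * x := by
    intro x
    -- Up to a factor 4, this vector is the Peirce 1/2-component of `x` for `e`.
    have h1 : (c + d) * (e * x - e * (e * x)) = (1 / 2 : ℝ) • (e * x - e * (e * x)) := by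
      rw [hsum, sub_mul, one_mul, mul_sub]
      linear_combination (norm := module) (1 / 2 : ℝ) • peirce_cubic he x
    have h2 := eq_zero_of_add_mul_eq_half hc hcd hK h1 hd
    have h3 := eq_zero_of_add_mul_eq_half hd hdc hK' (by rw [add_comm, h1]) hc
    rw [add_mul, h2, h3, add_zero] at h1
    exact (sub_eq_zero.1 ((smul_eq_zero.1 h1.symm).resolve_left (by norm_num))).symm
  let I : Submodule ℝ V := LinearMap.ker (LinearMap.mulLeft ℝ e - LinearMap.id)
  have hI : ∀ x : V, x ∈ I ↔ e * x = x := by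
    intro x
    simp [I, LinearMap.mem_ker, sub_eq_zero]
  rcases hsimple.2 I (fun y x hx => (hI _).2 (mul_mem_peirce_one he hee y ((hI x).1 hx)))
    with h | h
  · have h1 : e ∈ I := (hI e).2 he
    rw [h, Submodule.mem_bot] at h1
    rw [hsum, h1, sub_zero]
  · have h1 : c ∈ I := by rw [h]; trivial
    rw [hI, he_def, sub_mul, sub_mul, one_mul, hc, hdc, sub_self, sub_zero] at h1
    exact absurd h1.symm hc0

theorem exists_quadratic_of_add_eq_one {c d : V} (hc : c * c = c)
    (hd : d * d = d) (hcd : c * d = 0) (h1 : c + d = 1)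
    (hK : ∀ x : V, d * x = 0 → ∃ κ : ℝ, c * x = κ • c)
    (hK' : ∀ x : V, c * x = 0 → ∃ κ : ℝ, d * x = κ • d) (x : V) :
    ∃ s t : ℝ, x * x = s • x + t • (1 : V) := by
  have hdx : ∀ y : V, d * y = y - c * y := by
    intro y
    rw [eq_sub_iff_add_eq, ← add_mul, add_comm d c, h1, one_mul]
  have hone : ∀ y : V, c * y = y → ∃ κ : ℝ, y = κ • c := by
    intro y hy
    obtain ⟨κ, hκ⟩ := hK y (by rw [hdx, hy, sub_self])
    exact ⟨κ, by rw [← hκ, hy]⟩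
  have hzero : ∀ y : V, c * y = 0 → ∃ κ : ℝ, y = κ • d := by
    intro y hy
    obtain ⟨κ, hκ⟩ := hK' y hy
    exact ⟨κ, by rw [← hκ, hdx, hy, sub_zero]⟩
  have hcub := peirce_cubic hc x
  -- Lagrange interpolation at 1, 0, 1/2: `2t² - t`, `1 - 3t + 2t²` and `4(t - t²)` give the Peirce
  -- components of `x`.
  obtain ⟨μ, hμ⟩ := hone ((2 : ℝ) • (c * (c * x)) - c * x) (by
    rw [mul_sub, mul_smul_comm, ← sub_eq_zero, ← hcub]; module)
  obtain ⟨ν, hν⟩ := hzero (x - (3 : ℝ) • (c * x) + (2 : ℝ) • (c * (c * x))) (by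
    rw [mul_add, mul_sub, mul_smul_comm, mul_smul_comm, ← hcub]; module)
  obtain ⟨v, hv⟩ : ∃ v, v = (4 : ℝ) • (c * x - c * (c * x)) := ⟨_, rfl⟩
  have hx : x = μ • c + ν • d + v := by rw [← hμ, ← hν, hv]; module
  have hcv : c * v = (1 / 2 : ℝ) • v := by
    rw [hv, mul_smul_comm, mul_sub]
    linear_combination (norm := module) (-2 : ℝ) • hcub
  have hdv : d * v = (1 / 2 : ℝ) • v := by rw [hdx, hcv]; module
  have hvv : c * (c * (v * v)) = c * (v * v) := by
    have h := jordan_linearized v c c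
    rw [mul_comm v c, hcv, smul_mul_assoc, mul_comm v c, hcv, mul_smul_comm, mul_smul_comm,
      smul_mul_smul_comm, mul_comm (v * v) c, hc, mul_comm (v * v) c] at h
    rw [← sub_eq_zero, ← h]
    module
  obtain ⟨κ, hκ⟩ := hone _ hvv
  obtain ⟨κ', hκ'⟩ := hzero (v * v - c * (v * v)) (by rw [mul_sub, hvv, sub_self])
  have hvv' : v * v = κ • c + κ' • d := by rw [← hκ, ← hκ']; abel
  have hvvt : ∃ t : ℝ, v * v = t • (1 : V) := by
    by_cases hv0 : v = 0
    · exact ⟨0, by rw [hv0, mul_zero, zero_smul]⟩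
    -- The Jordan identity forces the coefficients of `c` and `d` in `v * v` to agree.
    have h := jordan_identity v c
    rw [mul_comm v c, hcv, hκ, smul_mul_assoc, hvv', mul_add, mul_smul_comm, mul_smul_comm,
      mul_comm v c, mul_comm v d, hcv, hdv] at h
    have h2 : ((κ' - κ) / 4) • v = 0 := by
      linear_combination (norm := module) h
    have h3 : κ' = κ := by
      have := (smul_eq_zero.1 h2).resolve_right hv0
      linarith
    exact ⟨κ, by rw [hvv', h3, ← smul_add, h1]⟩
  obtain ⟨t, ht⟩ := hvvt
  refine ⟨μ + ν, t - μ * ν, ?_⟩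
  have hdc : d * c = 0 := by rw [mul_comm, hcd]
  have e : x * x = (μ * μ) • c + (ν * ν) • d + (μ + ν) • v + v * v := by
    rw [hx]
    simp only [add_mul, mul_add, smul_mul_assoc, mul_smul_comm, hc, hd, hcd, hdc, hcv, hdv,
      mul_comm v c, mul_comm v d]
    module
  rw [e, ht, hx, sub_smul, ← h1]
  module

theorem jordanRank_le_two (h : ∀ x : V, ∃ s t : ℝ, x * x = s • x + t • (1 : V)) :
    jordanRank V ≤ 2 := by
  refine csSup_le (Set.range_nonempty _) ?_
  rintro _ ⟨x, rfl⟩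
  refine Nat.sInf_le ⟨two_pos, fun hli => ?_⟩
  obtain ⟨s, t, hst⟩ := h x
  have h0 := Fintype.linearIndependent_iff.1 hli ![t, s, -1] (by
    simp [Fin.sum_univ_succ, jordanPow, hst]) 2
  simp at h0

/-- The alternative `d = 0` covers normals with a single nonzero eigenvalue. -/
theorem SeparatesIdempotents.exists_quadratic (hsimple : IsSimpleJordan V) {a : V}
    (h : SeparatesIdempotents a) {α β : ℝ} (hα : 0 < α) {c d : V} (hc : c * c = c)
    (hd : d * d = d) (hcd : c * d = 0) (hc0 : c ≠ 0) (hβ : 0 < β ∨ d = 0)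
    (ha : a = α • c - β • d) (x : V) : ∃ s t : ℝ, x * x = s • x + t • (1 : V) := by
  have hK : ∀ x : V, d * x = 0 → ∃ κ : ℝ, c * x = κ • c :=
    fun x hx => h.mul_eq_smul hα hc hd hcd ha hx
  have hK' : ∀ x : V, c * x = 0 → ∃ κ : ℝ, d * x = κ • d := by
    intro x hx
    rcases hβ with hβ | rfl
    · exact h.neg.mul_eq_smul hβ hd hc (by rw [mul_comm, hcd]) (by rw [ha, neg_sub]) hx
    · exact ⟨0, by rw [zero_mul, smul_zero]⟩
  exact exists_quadratic_of_add_eq_one hc hd hcd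
    (add_eq_one_of_simple hsimple hc hd hcd hc0 hK hK') hK hK' x

theorem not_separatesIdempotents (hsimple : IsSimpleJordan V) (hrank : 3 ≤ jordanRank V)
    {a : V} (ha : a ≠ 0) : ¬ SeparatesIdempotents a := by
  classical
  intro h
  suffices hq : ∀ x : V, ∃ s t : ℝ, x * x = s • x + t • (1 : V) by
    have := jordanRank_le_two hq
    omega
  obtain ⟨s, c, hc, ho, -, hac⟩ := exists_spectral_decomposition a
  have hinner : ∀ i ∈ s, ⟪a, c i⟫ = i * ⟪c i, c i⟫ := by
    intro i hi
    rw [← hac, sum_inner, Finset.sum_eq_single i _ (fun h => absurd hi h), real_inner_smul_left]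
    intro j hj hji
    rw [real_inner_smul_left, inner_eq_zero_of_mul_eq_zero (hc i hi) (ho j hj i hi hji), mul_zero]
  -- At most one eigenvalue of each sign survives; the decomposition may contain zero idempotents,
  -- hence the nonvanishing conditions.
  have hsign : ∀ i ∈ s, ∀ j ∈ s, c i ≠ 0 → c j ≠ 0 → 0 < i * j → i = j := by
    intro i hi j hj hi0 hj0 hij
    by_contra hne
    have h1 := h _ _ (hc i hi) (hc j hj) (ho i hi j hj hne)
    rw [hinner i hi, hinner j hj] at h1
    have h2 := mul_pos hij (mul_pos (real_inner_self_pos.2 hi0) (real_inner_self_pos.2 hj0))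
    linarith
  by_cases hP : ∃ i ∈ s, 0 < i ∧ c i ≠ 0
  · obtain ⟨i, hi, hipos, hi0⟩ := hP
    by_cases hN : ∃ j ∈ s, j < 0 ∧ c j ≠ 0
    · obtain ⟨j, hj, hjneg, hj0⟩ := hN
      have hij : i ≠ j := by linarith [hipos, hjneg]
      refine h.exists_quadratic hsimple hipos (hc i hi) (hc j hj) (ho i hi j hj hij) hi0
        (Or.inl (neg_pos.2 hjneg)) ?_
      rw [← hac, Finset.sum_eq_add_of_mem i j hi hj hij, neg_smul, sub_neg_eq_add]
      intro k hk hkij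
      by_contra hk0
      rw [smul_eq_zero, not_or] at hk0
      rcases lt_or_gt_of_ne hk0.1 with hk1 | hk1
      · exact hkij.2 (hsign k hk j hj hk0.2 hj0 (mul_pos_of_neg_of_neg hk1 hjneg))
      · exact hkij.1 (hsign k hk i hi hk0.2 hi0 (mul_pos hk1 hipos))
    · push Not at hN
      refine h.exists_quadratic hsimple hipos (hc i hi) (mul_zero 0) (mul_zero _) hi0
        (β := 0) (Or.inr rfl) ?_
      rw [← hac, Finset.sum_eq_single i _ (fun h => absurd hi h), smul_zero, sub_zero]
      intro k hk hki
      by_contra hk0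
      rw [smul_eq_zero, not_or] at hk0
      rcases lt_or_gt_of_ne hk0.1 with hk1 | hk1
      · exact hk0.2 (hN k hk hk1)
      · exact hki (hsign k hk i hi hk0.2 hi0 (mul_pos hk1 hipos))
  · push Not at hP
    by_cases hN : ∃ j ∈ s, j < 0 ∧ c j ≠ 0
    · obtain ⟨j, hj, hjneg, hj0⟩ := hN
      refine h.neg.exists_quadratic hsimple (neg_pos.2 hjneg) (hc j hj) (mul_zero 0)
        (mul_zero _) hj0 (β := 0) (Or.inr rfl) ?_
      rw [← hac, Finset.sum_eq_single j _ (fun h => absurd hj h), smul_zero, sub_zero, neg_smul]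
      intro k hk hkj
      by_contra hk0
      rw [smul_eq_zero, not_or] at hk0
      rcases lt_or_gt_of_ne hk0.1 with hk1 | hk1
      · exact hkj (hsign k hk j hj hk0.2 hj0 (mul_pos_of_neg_of_neg hk1 hjneg))
      · exact hk0.2 (hP k hk hk1)
    · push Not at hN
      refine absurd ?_ ha
      rw [← hac]
      refine Finset.sum_eq_zero fun k hk => ?_
      by_contra hk0
      rw [smul_eq_zero, not_or] at hk0
      rcases lt_or_gt_of_ne hk0.1 with hk1 | hk1
      · exact hk0.2 (hN k hk hk1)
      · exact hk0.2 (hP k hk hk1)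

end JordanHyperplane

/-! ### Moreau decomposition and the two obstructions for hyperplanes. -/

section Projections

variable {E : Type*} [NormedAddCommGroup E] [InnerProductSpace ℝ E]

/-- Moreau's decomposition for a cone contained in its dual: if `p, n ∈ K` are orthogonal then
`x ⊓_K (x - (p - n)) = x - p`. -/
theorem latMeet_sub_sub {K : Set E} (hK : ∀ p ∈ K, ∀ q ∈ K, 0 ≤ ⟪p, q⟫) {p n : E}
    (hp : p ∈ K) (hn : n ∈ K) (hpn : ⟪p, n⟫ = 0) (x : E) :
    latMeet K x (x - (p - n)) = x - p := by
  -- `K` need not be closed or convex here; the term `‖q - p‖ ^ 2` gives uniqueness of the nearest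
  -- point directly.
  have hpy : ∀ q ∈ K, ‖n‖ ^ 2 + ‖q - p‖ ^ 2 ≤ ‖x - (p - n) - (x - q)‖ ^ 2 := by
    intro q hq
    have e : x - (p - n) - (x - q) = n + (q - p) := by abel
    have h := hK q hq n hn
    rw [e, norm_add_sq_real, inner_sub_right, real_inner_comm, real_inner_comm p n, hpn]
    linarith
  have hnear : IsNearestPoint ((fun k => x - k) '' K) (x - (p - n)) (x - p) := by
    refine ⟨⟨p, hp, rfl⟩, ?_⟩
    have : Nonempty ((fun k => x - k) '' K : Set E) := ⟨⟨x - p, p, hp, rfl⟩⟩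
    have e : x - (p - n) - (x - p) = n := by abel
    refine le_antisymm (le_ciInf ?_) ?_
    · rintro ⟨_, q, hq, rfl⟩
      rw [e]
      refine le_of_sq_le_sq ?_ (norm_nonneg _)
      exact (le_add_of_nonneg_right (sq_nonneg _)).trans (hpy q hq)
    · exact ciInf_le (f := fun y : ((fun k => x - k) '' K : Set E) => ‖x - (p - n) - (y : E)‖)
        ⟨0, by rintro _ ⟨y, rfl⟩; exact norm_nonneg _⟩ ⟨x - p, p, hp, rfl⟩
  have hspec : IsNearestPoint ((fun k => x - k) '' K) (x - (p - n)) (latMeet K x (x - (p - n))) :=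
    Classical.epsilon_spec
      (p := fun y => IsNearestPoint ((fun k => x - k) '' K) (x - (p - n)) y) ⟨_, hnear⟩
  obtain ⟨⟨q, hq, hqe⟩, hmin⟩ := hspec
  rw [← hnear.2, ← hqe] at hmin
  have h := hpy q hq
  simp only at hmin
  rw [hmin, show x - (p - n) - (x - p) = n by abel] at h
  have h2 : ‖q - p‖ ^ 2 = 0 := le_antisymm (by linarith) (sq_nonneg _)
  have h3 : q = p := sub_eq_zero.1 (norm_eq_zero.1 (pow_eq_zero_iff two_ne_zero |>.1 h2))
  rw [← hqe, h3]

theorem metricProj_hyperplane (u : E) {a : E} (ha : a ≠ 0) (x : E) :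
    metricProj (hyperplane u a) x = x - ((⟪a, x⟫ - ⟪a, u⟫) / ⟪a, a⟫) • a := by
  have haa : ⟪a, a⟫ ≠ 0 := inner_self_ne_zero.2 ha
  have hconv : Convex ℝ (hyperplane u a) := by
    intro y hy z hz s t _ _ hst
    simp only [hyperplane, Set.mem_ofPred_eq] at hy hz ⊢
    rw [inner_add_right, real_inner_smul_right, real_inner_smul_right, hy, hz, ← add_mul, hst,
      one_mul]
  have hmem : x - ((⟪a, x⟫ - ⟪a, u⟫) / ⟪a, a⟫) • a ∈ hyperplane u a := by
    simp only [hyperplane, Set.mem_ofPred_eq]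
    rw [inner_sub_right, real_inner_smul_right, div_mul_cancel₀ _ haa]
    ring
  have hnear : IsNearestPoint (hyperplane u a) x (x - ((⟪a, x⟫ - ⟪a, u⟫) / ⟪a, a⟫) • a) := by
    refine ⟨hmem, (norm_eq_iInf_iff_real_inner_le_zero hconv hmem).2 fun w hw => ?_⟩
    rw [sub_sub_cancel, real_inner_smul_left, inner_sub_right, hw.trans hmem.symm, sub_self,
      mul_zero]
  exact isNearestPoint_unique hconv (Classical.epsilon_spec
    (p := fun y => IsNearestPoint (hyperplane u a) x y) ⟨_, hnear⟩) hnear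

/-- With `s = |⟪a, q⟫|` and `t = |⟪a, p⟫|`, the point `u - (s • p - t • q)` lies in the hyperplane,
but its meet with `u` is `u - s • p`, which does not. -/
theorem not_isLatticeLike_hyperplane {K : Set E} (hK : ∀ p ∈ K, ∀ q ∈ K, 0 ≤ ⟪p, q⟫)
    (hsmul : ∀ t : ℝ, 0 ≤ t → ∀ p ∈ K, t • p ∈ K) {a p q : E} (hp : p ∈ K) (hq : q ∈ K)
    (hpq : ⟪p, q⟫ = 0) (h : 0 < ⟪a, p⟫ * ⟪a, q⟫) (u : E) :
    ¬ IsLatticeLike K (hyperplane u a) := by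
  intro hL
  have key : ∀ s t : ℝ, 0 ≤ s → 0 ≤ t → s * ⟪a, p⟫ = t * ⟪a, q⟫ → s * ⟪a, p⟫ = 0 := by
    intro s t hs ht hst
    have h1 := (hL u rfl (u - (s • p - t • q)) (by
      simp only [hyperplane, Set.mem_ofPred_eq]
      rw [inner_sub_right, inner_sub_right, real_inner_smul_right, real_inner_smul_right, hst,
        sub_self, sub_zero])).1
    rw [latMeet_sub_sub hK (hsmul s hs p hp) (hsmul t ht q hq) (by
      rw [real_inner_smul_left, real_inner_smul_right, hpq, mul_zero, mul_zero])] at h1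
    simp only [hyperplane, Set.mem_ofPred_eq] at h1
    rw [inner_sub_right, real_inner_smul_right] at h1
    linarith
  have h1 := key |⟪a, q⟫| |⟪a, p⟫| (abs_nonneg _) (abs_nonneg _) (by
    rcases pos_and_pos_or_neg_and_neg_of_mul_pos h with ⟨h1, h2⟩ | ⟨h1, h2⟩
    · rw [abs_of_pos h1, abs_of_pos h2, mul_comm]
    · rw [abs_of_neg h1, abs_of_neg h2, neg_mul, neg_mul, mul_comm])
  rcases mul_eq_zero.1 h1 with h2 | h2
  · rw [abs_eq_zero.1 h2, mul_zero] at h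
    exact lt_irrefl _ h
  · rw [h2, zero_mul] at h
    exact lt_irrefl _ h

/-- The projections of `0` and `p` differ by `p - (⟪a, p⟫ / ⟪a, a⟫) • a`, whose inner product with
`q ∈ K` is negative. -/
theorem not_isIsotoneProj_hyperplane {K : Set E} (hK : ∀ p ∈ K, ∀ q ∈ K, 0 ≤ ⟪p, q⟫)
    {a p q : E} (hp : p ∈ K) (hq : q ∈ K)
    (hpq : ⟪p, q⟫ = 0) (h : 0 < ⟪a, p⟫ * ⟪a, q⟫) (u : E) :
    ¬ IsIsotoneProj K (hyperplane u a) := by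
  intro hI
  have ha : a ≠ 0 := by
    rintro rfl
    rw [inner_zero_left, zero_mul] at h
    exact lt_irrefl _ h
  have haa : 0 < ⟪a, a⟫ := real_inner_self_pos.2 ha
  have h1 := hI 0 p (by rwa [coneLE, sub_zero])
  rw [coneLE, metricProj_hyperplane u ha, metricProj_hyperplane u ha] at h1
  have h2 := hK _ h1 q hq
  rw [inner_sub_left, inner_sub_left, inner_sub_left, real_inner_smul_left, real_inner_smul_left,
    hpq, inner_zero_left, inner_zero_right] at h2
  have h3 := div_pos h haa
  have h4 : 0 - (⟪a, p⟫ - ⟪a, u⟫) / ⟪a, a⟫ * ⟪a, q⟫ - (0 - (0 - ⟪a, u⟫) / ⟪a, a⟫ * ⟪a, q⟫)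
      = - (⟪a, p⟫ * ⟪a, q⟫ / ⟪a, a⟫) := by ring
  linarith

end Projections

theorem mainTheorem1 {V : Type*} [EuclideanJordanAlgebra V] (hsimple : IsSimpleJordan V)
    (hrank : 3 ≤ jordanRank V) (u a : V) (ha : a ≠ 0) :
    ¬ IsLatticeLike (squareCone V) (hyperplane u a) ∧
      ¬ IsIsotoneProj (squareCone V) (hyperplane u a) := by
  have hK : ∀ p ∈ squareCone V, ∀ q ∈ squareCone V, 0 ≤ ⟪p, q⟫ := by
    rintro _ ⟨x, rfl⟩ _ ⟨y, rfl⟩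
    exact inner_mul_self_mul_self_nonneg x y
  have hsmul : ∀ t : ℝ, 0 ≤ t → ∀ p ∈ squareCone V, t • p ∈ squareCone V := by
    rintro t ht _ ⟨x, rfl⟩
    exact ⟨√t • x, by rw [smul_mul_smul_comm, Real.mul_self_sqrt ht]⟩
  have h := not_separatesIdempotents hsimple hrank ha
  unfold SeparatesIdempotents at h
  push Not at h
  obtain ⟨p, q, hp, hq, hpq, hpos⟩ := h
  have hp' : p ∈ squareCone V := ⟨p, hp.symm⟩
  have hq' : q ∈ squareCone V := ⟨q, hq.symm⟩
  have hpq' := inner_eq_zero_of_mul_eq_zero hq hpq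
  exact ⟨not_isLatticeLike_hyperplane hK hsmul hp' hq' hpq' hpos u,
    not_isIsotoneProj_hyperplane hK hp' hq' hpq' hpos u⟩
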